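/- Let $m, n \ge 0$ be integers, let $\mathbb{F}$ be the free group on $m$ generators, and let $S_n \subset \mathbb{F}$ be the finite set of elements whose reduced word has length at most $n$. Let $\mathcal{H}$ be a complex Hilbert space and let $T = (T_{s,t})_{s,t \in S_n}$ be a block matrix of bounded operators $T_{s,t} \in \mathcal{L}(\mathcal{H})$ which is Toeplitz, that is, $T_{s,t} = T_{s',t'}$ whenever $s,t,s',t' \in S_n$ and $s^{-1}t = s'^{-1}t'$, and positive, that is, the operator $(h_t)_{t} \mapsto \bigl(\sum_{t} T_{s,t} h_t\bigr)_{s}$ on $\bigoplus_{s \in S_n} \mathcal{H}$ is positive semidefinite. Then there exist a complex Hilbert space $\mathcal{K}$, a unitary representation $\pi$ of $\mathbb{F}$ on $\mathcal{K}$, and a bounded operator $V : \mathcal{H} \to \mathcal{K}$ such that $$T_{s,t} = V^* \pi(s^{-1}t) V \qquad \text{for all } s, t \in S_n.$$ -/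

import Mathlib

universe u

/-- The set of all elements of the free group on `m` generators whose reduced word has length
at most `n`. -/
def wordBall (m n : ℕ) : Set (FreeGroup (Fin m)) := {s | s.norm ≤ n}

theorem finite_wordBall (m n : ℕ) : (wordBall m n).Finite :=
  ((List.finite_length_le (Fin m × Bool) n).preimage
    FreeGroup.toWord_injective.injOn).subset (fun _ hs => hs)

noncomputable instance instFintypeWordBall (m n : ℕ) : Fintype (wordBall m n) :=
  (finite_wordBall m n).fintype

/-- Block operator matrices with entries bounded operators on `H`, with rows and columns indexed
by the words of length at most `n`. -/
abbrev BlockMatrix (m n : ℕ) (H : Type*) [NormedAddCommGroup H] [InnerProductSpace ℂ H] :=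
  Matrix (wordBall m n) (wordBall m n) (H →L[ℂ] H)

namespace BlockMatrix

variable {m n : ℕ} {H : Type*} [NormedAddCommGroup H] [InnerProductSpace ℂ H]

/-- The entries of `T` depend only on `s⁻¹ t`. -/
def IsToeplitz (T : BlockMatrix m n H) : Prop :=
  ∀ s t s' t' : wordBall m n,
    (s : FreeGroup (Fin m))⁻¹ * t = (s' : FreeGroup (Fin m))⁻¹ * t' → T s t = T s' t'

/-- The bounded operator induced by a block matrix on the Hilbert direct sum of copies of `H`
indexed by the words of length at most `n`: `(T x)_s = ∑ t, T_{s,t} x_t`. -/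
noncomputable def toOperator (T : BlockMatrix m n H) :
    PiLp 2 (fun _ : wordBall m n => H) →L[ℂ] PiLp 2 (fun _ : wordBall m n => H) :=
  ((PiLp.continuousLinearEquiv 2 ℂ (fun _ : wordBall m n => H)).symm :
      (wordBall m n → H) →L[ℂ] PiLp 2 (fun _ : wordBall m n => H)) ∘L
    ContinuousLinearMap.pi fun s =>
      ∑ t, T s t ∘L PiLp.proj 2 (fun _ : wordBall m n => H) t

theorem toOperator_apply (T : BlockMatrix m n H) (x : PiLp 2 (fun _ : wordBall m n => H))
    (s : wordBall m n) : T.toOperator x s = ∑ t, T s t (x t) := by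
  simp [toOperator]

/-- A block matrix is positive if the operator it induces on the Hilbert direct sum is a positive
(semidefinite) operator. -/
def IsPositive (T : BlockMatrix m n H) : Prop := T.toOperator.IsPositive

end BlockMatrix

/-! Positivity factors `T` as a Gram matrix, $T_{s,t} = v_s^* v_t$. For a generator $a$,
$(as)^{-1}(at) = s^{-1}t$, so by the Toeplitz property $v_s h \mapsto v_{as} h$ (for $s, as \in
S_n$) preserves inner products and extends to a unitary on $E \oplus E$. Freeness makes any choice
of unitaries on the generators a representation $\pi$. Each suffix of a word of length at most $n$
stays in $S_n$, so letter by letter $\pi(s) v_1 = v_s$, and $V = v_1$ works. -/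

open ContinuousLinearMap in
/-- Halmos' unitary dilation of a partial isometry. -/
theorem exists_unitary_dilation_of_partialIsometry {E : Type*} [NormedAddCommGroup E]
    [InnerProductSpace ℂ E] [CompleteSpace E] (C : E →L[ℂ] E)
    (hC : ∀ x, C (adjoint C (C x)) = C x) :
    ∃ W : unitary (WithLp 2 (E × E) →L[ℂ] WithLp 2 (E × E)), ∀ x, adjoint C (C x) = x →
      (W : WithLp 2 (E × E) →L[ℂ] WithLp 2 (E × E)) (WithLp.toLp 2 (x, 0)) =
        WithLp.toLp 2 (C x, 0) := by
  have hC' : ∀ x, adjoint C (C (adjoint C x)) = adjoint C x := fun x =>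
    ext_inner_right ℂ fun y => by
      simp only [adjoint_inner_left, ← adjoint_inner_right C, hC]
  -- The block matrix $\begin{pmatrix} C & 1 - CC^* \\ 1 - C^*C & -C^* \end{pmatrix}$, with its
  -- adjoint as inverse. The defect operators are already projections, so no square roots are
  -- needed.
  let W : WithLp 2 (E × E) ≃ₗ[ℂ] WithLp 2 (E × E) :=
    { toFun := fun z => WithLp.toLp 2
        (C z.fst + (z.snd - C (adjoint C z.snd)), z.fst - adjoint C (C z.fst) - adjoint C z.snd)
      invFun := fun z => WithLp.toLp 2
        (adjoint C z.fst + (z.snd - adjoint C (C z.snd)), z.fst - C (adjoint C z.fst) - C z.snd)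
      map_add' := fun z w => by
        apply WithLp.ofLp_injective
        ext <;> simp <;> abel
      map_smul' := fun c z => by
        apply WithLp.ofLp_injective
        ext <;> simp [smul_sub]
      left_inv := fun z => by
        apply WithLp.ofLp_injective
        ext <;> simp [hC, hC']
      right_inv := fun z => by
        apply WithLp.ofLp_injective
        ext <;> simp [hC, hC'] }
  have hW : ∀ z w, inner ℂ (W z) w = inner ℂ z (W.symm w) := fun z w => by
    change inner ℂ (WithLp.toLp 2 (_, _)) w = inner ℂ z (WithLp.toLp 2 (_, _))
    have hCC : ∀ x y, inner ℂ (C (adjoint C x)) y = inner ℂ x (C (adjoint C y)) := fun x y => by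
      rw [← adjoint_inner_right, adjoint_inner_left]
    simp only [WithLp.prod_inner_apply, inner_add_left, inner_sub_left, inner_add_right,
      inner_sub_right, hCC, adjoint_inner_left, adjoint_inner_right, WithLp.fst, WithLp.snd]
    ring
  let W' : WithLp 2 (E × E) ≃ₗᵢ[ℂ] WithLp 2 (E × E) :=
    W.isometryOfInner fun z w => by rw [hW, W.symm_apply_apply]
  refine ⟨Unitary.linearIsometryEquiv.symm W', fun x hx => ?_⟩
  change WithLp.toLp 2 (_, _) = _
  simp [hx]

open ContinuousLinearMap in
/-- An isometry between two subspaces of `E`, given by a pair of linear maps `f`, `g` with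
`‖f x‖ = ‖g x‖`, extends to a unitary operator on `E ⊕ E`. -/
theorem exists_unitary_extension {X E : Type*} [AddCommGroup X] [Module ℂ X]
    [NormedAddCommGroup E] [InnerProductSpace ℂ E] [CompleteSpace E] (f g : X →ₗ[ℂ] E)
    (hfg : ∀ x, ‖f x‖ = ‖g x‖) :
    ∃ W : unitary (WithLp 2 (E × E) →L[ℂ] WithLp 2 (E × E)), ∀ x,
      (W : WithLp 2 (E × E) →L[ℂ] WithLp 2 (E × E)) (WithLp.toLp 2 (f x, 0)) =
        WithLp.toLp 2 (g x, 0) := by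
  let D : Submodule ℂ E := (LinearMap.range f).topologicalClosure
  have : CompleteSpace D := (Submodule.isClosed_topologicalClosure _).completeSpace_coe
  let e : X →ₗ[ℂ] D := f.codRestrict D fun x =>
    Submodule.le_topologicalClosure _ (LinearMap.mem_range_self f x)
  have he : DenseRange e := by
    rw [DenseRange, Topology.IsInducing.subtypeVal.dense_iff]
    intro y
    have hr : Subtype.val '' Set.range e = (LinearMap.range f : Set E) := by
      rw [← Set.range_comp]
      rfl
    exact hr ▸ y.2
  have hbound : ∀ x, ‖g x‖ ≤ 1 * ‖e x‖ := fun x => by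
    rw [one_mul, ← hfg]
    rfl
  -- The norm bound makes $f x \mapsto g x$ well defined and continuous, so it extends to the
  -- closure `D`.
  let J : D →L[ℂ] E := g.extendOfNorm e
  have hJe : ∀ x, J (e x) = g x := LinearMap.extendOfNorm_eq he ⟨1, hbound⟩
  have hJ : adjoint J ∘L J = 1 := by
    rw [← norm_map_iff_adjoint_comp_self]
    refine he.induction ?_ (isClosed_eq (by fun_prop) (by fun_prop))
    rintro _ ⟨x, rfl⟩
    rw [hJe, ← hfg]
    rfl
  have hI : adjoint D.subtypeL ∘L D.subtypeL = 1 :=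
    (norm_map_iff_adjoint_comp_self _).1 fun _ => rfl
  have hJ' : ∀ x, adjoint J (J x) = x := fun x => congr($hJ x)
  have hI' : ∀ x : D, adjoint D.subtypeL (x : E) = x := fun x => congr($hI x)
  -- The adjoint of the inclusion is the orthogonal projection onto `D`, so this is a partial
  -- isometry with initial space `D`.
  obtain ⟨W, hW⟩ := exists_unitary_dilation_of_partialIsometry (J ∘L adjoint D.subtypeL)
    fun x => by simp [adjoint_comp, hJ', hI']
  refine ⟨W, fun x => ?_⟩
  have hfe : f x = (e x : E) := rfl
  rw [hfe, hW _ (by simp [adjoint_comp, hJ', hI'])]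
  simp [hI', hJe]

open ContinuousLinearMap in
/-- Kolmogorov decomposition of a positive block matrix. -/
theorem BlockMatrix.IsPositive.exists_kolmogorov {m n : ℕ} {H : Type u} [NormedAddCommGroup H]
    [InnerProductSpace ℂ H] [CompleteSpace H] {T : BlockMatrix m n H} (hT : T.IsPositive) :
    ∃ (E : Type u) (_ : NormedAddCommGroup E) (_ : InnerProductSpace ℂ E) (_ : CompleteSpace E)
      (v : wordBall m n → H →L[ℂ] E),
      ∀ s t h k, inner ℂ (v s h) (v t k) = inner ℂ h (T s t k) := by
  classical
  let B := CFC.sqrt T.toOperator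
  have hBsa : IsSelfAdjoint B := (CFC.sqrt_nonneg T.toOperator).isSelfAdjoint
  have hBB : B * B = T.toOperator :=
    CFC.sqrt_mul_sqrt_self _ ((nonneg_iff_isPositive _).2 hT)
  refine ⟨PiLp 2 (fun _ : wordBall m n => H), inferInstance, inferInstance, inferInstance,
    fun s => B ∘L ((PiLp.continuousLinearEquiv 2 ℂ (fun _ : wordBall m n => H)).symm :
      (wordBall m n → H) →L[ℂ] PiLp 2 (fun _ : wordBall m n => H)) ∘L
        ContinuousLinearMap.single ℂ (fun _ : wordBall m n => H) s, fun s t h k => ?_⟩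
  simp only [coe_comp, Function.comp_apply]
  rw [← adjoint_inner_right, ← star_eq_adjoint, hBsa.star_eq, ← mul_apply_eq_comp, hBB, PiLp.inner_apply,
    Finset.sum_eq_single s, BlockMatrix.toOperator_apply, Finset.sum_eq_single t]
  · simp
  · intro b _ hb
    simp [hb]
  · simp
  · intro b _ hb
    simp [hb]
  · simp

/-- The isometric partial translations of a Toeplitz Kolmogorov decomposition extend to
unitary operators. -/
theorem exists_unitary_translation {m n : ℕ} {H E : Type*} [NormedAddCommGroup H]
    [InnerProductSpace ℂ H] [NormedAddCommGroup E] [InnerProductSpace ℂ E] [CompleteSpace E]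
    {T : BlockMatrix m n H} (hT : T.IsToeplitz) (v : wordBall m n → H →L[ℂ] E)
    (hv : ∀ s t h k, inner ℂ (v s h) (v t k) = inner ℂ h (T s t k)) (a : FreeGroup (Fin m)) :
    ∃ W : unitary (WithLp 2 (E × E) →L[ℂ] WithLp 2 (E × E)),
      ∀ s t : wordBall m n, (t : FreeGroup (Fin m)) = a * s → ∀ h,
        (W : WithLp 2 (E × E) →L[ℂ] WithLp 2 (E × E)) (WithLp.toLp 2 (v s h, 0)) =
          WithLp.toLp 2 (v t h, 0) := by
  classical
  let I := {p : wordBall m n × wordBall m n // (p.2 : FreeGroup (Fin m)) = a * p.1}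
  let f : (I → H) →ₗ[ℂ] E := ∑ p : I, (v p.1.1).toLinearMap ∘ₗ LinearMap.proj p
  let g : (I → H) →ₗ[ℂ] E := ∑ p : I, (v p.1.2).toLinearMap ∘ₗ LinearMap.proj p
  obtain ⟨W, hW⟩ := exists_unitary_extension f g fun x => by
    rw [norm_eq_sqrt_re_inner (𝕜 := ℂ), norm_eq_sqrt_re_inner (𝕜 := ℂ)]
    congr 2
    simp only [f, g, LinearMap.sum_apply, LinearMap.comp_apply, LinearMap.proj_apply,
      ContinuousLinearMap.coe_coe, sum_inner, inner_sum, hv]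
    refine Finset.sum_congr rfl fun p _ => Finset.sum_congr rfl fun q _ => ?_
    -- The factor $a$ cancels in $(as)^{-1}(at)$, so both Gram matrices agree.
    rw [hT q.1.1 p.1.1 q.1.2 p.1.2 (by rw [p.2, q.2]; group)]
  refine ⟨W, fun s t hst h => ?_⟩
  have key := hW (Pi.single ⟨(s, t), hst⟩ h)
  have hf : f (Pi.single ⟨(s, t), hst⟩ h) = v s h := by
    simp only [f, LinearMap.sum_apply]
    rw [Finset.sum_eq_single (⟨(s, t), hst⟩ : I)]
    · simp
    · intro b _ hb
      simp [hb]
    · simp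
  have hg : g (Pi.single ⟨(s, t), hst⟩ h) = v t h := by
    simp only [g, LinearMap.sum_apply]
    rw [Finset.sum_eq_single (⟨(s, t), hst⟩ : I)]
    · simp
    · intro b _ hb
      simp [hb]
    · simp
  rwa [hf, hg] at key

theorem mk_mem_wordBall {m n : ℕ} {L : List (Fin m × Bool)} (hL : L.length ≤ n) :
    FreeGroup.mk L ∈ wordBall m n :=
  FreeGroup.norm_mk_le.trans hL

theorem corollary4p8 (m n : ℕ)
    (H : Type u) [NormedAddCommGroup H] [InnerProductSpace ℂ H] [CompleteSpace H]
    (T : BlockMatrix m n H) (hToeplitz : T.IsToeplitz) (hPos : T.IsPositive) :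
    ∃ (K : Type u) (_ : NormedAddCommGroup K) (_ : InnerProductSpace ℂ K) (_ : CompleteSpace K)
      (π : FreeGroup (Fin m) →* unitary (K →L[ℂ] K)) (V : H →L[ℂ] K),
      ∀ s t : wordBall m n,
        T s t = ContinuousLinearMap.adjoint V ∘L
          (π ((s : FreeGroup (Fin m))⁻¹ * (t : FreeGroup (Fin m))) : K →L[ℂ] K) ∘L V := by
  obtain ⟨E, _, _, _, v, hv⟩ := hPos.exists_kolmogorov
  choose W hW using fun i => exists_unitary_translation hToeplitz v hv (FreeGroup.of i)
  let ι : E →L[ℂ] WithLp 2 (E × E) :=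
    ((WithLp.prodContinuousLinearEquiv 2 ℂ E E).symm : E × E →L[ℂ] WithLp 2 (E × E)) ∘L
      ContinuousLinearMap.inl ℂ E E
  have hι : ∀ x y, inner ℂ (ι x) (ι y) = inner ℂ x y := fun x y => by
    simp [ι, WithLp.prod_inner_apply]
  let o : wordBall m n := ⟨1, by simp [wordBall]⟩
  let π : FreeGroup (Fin m) →* unitary (WithLp 2 (E × E) →L[ℂ] WithLp 2 (E × E)) :=
    FreeGroup.lift W
  -- Induction runs over arbitrary words, reduced or not: the length bound passes to tails and
  -- bounds the norm.
  have hπ : ∀ (L : List (Fin m × Bool)) (hL : L.length ≤ n) (h : H),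
      (π (FreeGroup.mk L)).1 (ι (v o h)) = ι (v ⟨FreeGroup.mk L, mk_mem_wordBall hL⟩ h) := by
    intro L
    induction L with
    | nil =>
      intro hL h
      change (π 1).1 _ = _
      rw [map_one]
      rfl
    | cons a L ih =>
      intro hL h
      have hL' : L.length ≤ n := (Nat.le_succ _).trans hL
      have hcons : FreeGroup.mk (a :: L) = FreeGroup.mk [a] * FreeGroup.mk L := by simp
      have hmul : (π (FreeGroup.mk (a :: L))).1 (ι (v o h)) =
          (π (FreeGroup.mk [a])).1 ((π (FreeGroup.mk L)).1 (ι (v o h))) := by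
        rw [hcons, map_mul]
        rfl
      rw [hmul, ih hL']
      obtain ⟨i, _ | _⟩ := a
      · have hinv : FreeGroup.mk [(i, false)] = (FreeGroup.of i)⁻¹ := rfl
        -- For an inverse letter, `W i` carries the longer word's vector back to that of `L`; then
        -- invert.
        have hstep := hW i ⟨FreeGroup.mk ((i, false) :: L), mk_mem_wordBall hL⟩
          ⟨FreeGroup.mk L, mk_mem_wordBall hL'⟩ (by simp only [hcons, hinv]; group) h
        have hπi : π (FreeGroup.mk [(i, false)]) = (W i)⁻¹ := by
          rw [hinv, map_inv, FreeGroup.lift_apply_of]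
        rw [hπi]
        refine (congrArg ((W i)⁻¹).1 hstep.symm).trans ?_
        exact congr($(inv_mul_cancel (W i)).1 _)
      · have hπi : π (FreeGroup.mk [(i, true)]) = W i := FreeGroup.lift_apply_of
        rw [hπi]
        exact hW i _ _ hcons h
  have hπ' : ∀ (s : wordBall m n) (h : H), (π s).1 (ι (v o h)) = ι (v s h) := fun s h => by
    have := hπ (s : FreeGroup (Fin m)).toWord s.2 h
    simpa only [FreeGroup.mk_toWord] using this
  refine ⟨WithLp 2 (E × E), inferInstance, inferInstance, inferInstance, π, ι ∘L v o,
    fun s t => ?_⟩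
  ext k
  refine ext_inner_left ℂ fun h => ?_
  have hst : (π s).1 ((π ((s : FreeGroup (Fin m))⁻¹ * t)).1 (ι (v o k))) =
      (π t).1 (ι (v o k)) := by
    rw [← mul_apply_eq_comp]
    change (π s * π ((s : FreeGroup (Fin m))⁻¹ * t)).1 _ = _
    rw [← map_mul, mul_inv_cancel_left]
  simp only [ContinuousLinearMap.coe_comp, Function.comp_apply,
    ContinuousLinearMap.adjoint_inner_right]
  -- The unitary $\pi(s)$ now acts on both sides of the inner product and drops out.
  rw [← hv, ← hι, ← hπ' s, ← hπ' t, ← hst, Unitary.inner_map_map]
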